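/- Let $r\ge 0$, let $N=\mathrm{diag}(m_1,\dots,m_r)$ with integers $m_1\le\dots\le m_r$, and let $E_N=\bigoplus_j\mathcal O(m_j)$ be the bundle on $\mathbb{CP}^1$ with transition function $z^N$ between the trivializations over $\mathbb C$ (coordinate $z$) and over $\mathbb{CP}^1\setminus\{0\}$ (coordinate $\zeta=1/z$). An element of $\mathrm{Aut}(E_N)$ is a pair of holomorphic maps $g_0(z),g_1(\zeta)$ from $\mathbb C$ to $\mathrm{GL}(r,\mathbb C)$ with $g_0(z)=z^Ng_1(1/z)z^{-N}$ for $z\neq0$; it acts on connection forms over $\mathbb C$ by $g\cdot A=g_0Ag_0^{-1}-dg_0\,g_0^{-1}$. Let $z_1,\dots,z_{n-1}\in\mathbb C$ be distinct, $z_n=\infty$ ($n\ge1$), let $0\le\alpha_{i1}<\dots<\alpha_{ir}<1$ for $i=1,\dots,n$, put $W_i=\mathrm{diag}(\alpha_{i1},\dots,\alpha_{ir})$, and let $F_r$ be the descending flag of the spaces $\mathrm{Span}(e_j,\dots,e_r)$, $1\le j\le r$. Let $A$ be a logarithmic connection on $E_N$ adapted to complete descending flags $F_1,\dots,F_n$ and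 the weights $\alpha_{ij}$. This means that $A=\big(\sum_{i<n}\frac{A_i}{z-z_i}+f_0(z)\big)dz$ over $\mathbb C$ with $f_0$ entire, that $z^{-N}Az^N+N\,dz/z=\big(\frac{A_n}{\zeta}+\text{holomorphic}\big)d\zeta$ near $\zeta=0$, and that for each $i=1,\dots,n$ there is $B_i\in\mathrm{GL}(r,\mathbb C)$ with $A_i=B_iW_iB_i^{-1}$ and $F_i=B_i\cdot F_r$. Let $P_N\subset\mathrm{GL}(r,\mathbb C)$ be the group of invertible matrices $P$ with $P_{jk}=0$ whenever $m_j<m_k$. Then there is a permutation matrix $\Pi_n$ with $F_n\in P_N\Pi_n\cdot F_r$. For every such $\Pi_n$ (for instance the one for which $F_n$ lies in the Bruhat cell of $\Pi_n$), with $N'=\mathrm{Ad}(\Pi_n^{-1})(N)=\Pi_n^{-1}N\Pi_n$, the following hold. 1. There is $g\in\mathrm{Aut}(E_N)$ such that, in the trivialization over $\mathbb C$ with its frame permuted by $\Pi_n$, the connection $g\cdot A$ expands near $\infty$ as $$\Pi_n^{-1}(g\cdot A)\Pi_n=\Big(\frac{W_n+N'}{\zeta}+f_1'(\zeta)\Big)d\zeta,$$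 with $f_1'$ holomorphic at $\zeta=0$; equivalently, $g\cdot A=\big(\frac{\mathrm{Ad}(\Pi_n)(W_n+N')}{\zeta}+\text{holomorphic}\big)d\zeta$. 2. This normalization is essentially unique: for such a $g$, an element $h\in\mathrm{Aut}(E_N)$ also has the property in 1 (with the same $\Pi_n$) if and only if $h_0=Dg_0$ for a constant invertible diagonal matrix $D$. -/

import Mathlib

open Filter Topology

noncomputable section

/-- The adjoint action `Ad(g)(X) = g X g⁻¹` of an invertible matrix. -/
def matAd {r : ℕ} (g X : Matrix (Fin r) (Fin r) ℂ) : Matrix (Fin r) (Fin r) ℂ :=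
  g * X * g⁻¹

/-- The splitting matrix `N = diag(m₁, …, m_r)`. -/
def splitN {r : ℕ} (m : Fin r → ℤ) : Matrix (Fin r) (Fin r) ℂ :=
  Matrix.diagonal fun j => (m j : ℂ)

/-- The diagonal matrix `z ^ N = diag(z ^ m₁, …, z ^ m_r)`, used for `z ≠ 0`. -/
def powN {r : ℕ} (m : Fin r → ℤ) (z : ℂ) : Matrix (Fin r) (Fin r) ℂ :=
  Matrix.diagonal fun j => z ^ m j

/-- The diagonal matrix `diag(a₁, …, a_r)` of a system of real weights. -/
def weightW {r : ℕ} (a : Fin r → ℝ) : Matrix (Fin r) (Fin r) ℂ :=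
  Matrix.diagonal fun j => (a j : ℂ)

/-- A matrix-valued function on `ℂ` is entire. -/
def MatEntire {r : ℕ} (f : ℂ → Matrix (Fin r) (Fin r) ℂ) : Prop :=
  ∀ j k, Differentiable ℂ fun z => f z j k

/-- The entrywise complex derivative of a matrix-valued function. -/
def matDeriv {r : ℕ} (f : ℂ → Matrix (Fin r) (Fin r) ℂ) (z : ℂ) :
    Matrix (Fin r) (Fin r) ℂ :=
  Matrix.of fun j k => deriv (fun w => f w j k) z

/-- Near `ζ = 0`, the form `Φ(ζ) dζ` equals `(R / ζ + f(ζ)) dζ` with `f` holomorphic at `0`. -/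
def HasPolarPart {r : ℕ} (Φ : ℂ → Matrix (Fin r) (Fin r) ℂ)
    (R : Matrix (Fin r) (Fin r) ℂ) : Prop :=
  ∃ f : ℂ → Matrix (Fin r) (Fin r) ℂ, (∀ j k, AnalyticAt ℂ (fun ζ => f ζ j k) 0) ∧
    ∀ᶠ ζ in 𝓝[≠] (0 : ℂ), Φ ζ = ζ⁻¹ • R + f ζ

/-- The form `A(z) dz` rewritten in the coordinate `ζ = 1 / z`: since `dz = -ζ⁻² dζ`, it is
`-ζ⁻² A(1 / ζ) dζ`. -/
def inZeta {r : ℕ} (A : ℂ → Matrix (Fin r) (Fin r) ℂ) (ζ : ℂ) : Matrix (Fin r) (Fin r) ℂ :=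
  -((ζ ^ 2)⁻¹ • A ζ⁻¹)

/-- The connection form in the trivialization over the chart at `∞`, namely
`z ^ (-N) A(z) z ^ N dz + N dz / z`, in the coordinate `ζ = 1 / z`
(so that `z ^ (-N) = ζ ^ N` and `dz / z = -dζ / ζ`). -/
def formAtInfty {r : ℕ} (m : Fin r → ℤ) (A : ℂ → Matrix (Fin r) (Fin r) ℂ) (ζ : ℂ) :
    Matrix (Fin r) (Fin r) ℂ :=
  powN m ζ * inZeta A ζ * powN m ζ⁻¹ - ζ⁻¹ • splitN m

/-- The standard descending flag: the `j`-th space is spanned by `e_j, …, e_r`. -/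
def stdFlag (r : ℕ) (j : Fin r) : Submodule ℂ (Fin r → ℂ) :=
  Submodule.span ℂ {v | ∃ l, j ≤ l ∧ v = Pi.single l 1}

/-- The left action of matrices on families of subspaces (flags). -/
def flagAct {r : ℕ} (B : Matrix (Fin r) (Fin r) ℂ) (F : Fin r → Submodule ℂ (Fin r → ℂ)) :
    Fin r → Submodule ℂ (Fin r → ℂ) :=
  fun j => (F j).map B.mulVecLin

/-- The residue `R` is semisimple with ordered eigenvalues `a₁, …, a_r`, and its ordered eigenlines
span the complete descending flag `F`: `R = B diag(a) B⁻¹` where `F` is the image under `B` of the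
standard flag. -/
def ResidueAdapted {r : ℕ} (R : Matrix (Fin r) (Fin r) ℂ) (a : Fin r → ℝ)
    (F : Fin r → Submodule ℂ (Fin r → ℂ)) : Prop :=
  ∃ B : Matrix (Fin r) (Fin r) ℂ, IsUnit B ∧ R = matAd B (weightW a) ∧ F = flagAct B (stdFlag r)

/-- `A(z) dz` is a logarithmic connection on `E_N`, adapted to the flags `F` and the weights `α`,
with poles at the points `z i` of `ℂ` and at `∞` (which has the index `Fin.last k`).
The values of the function `A` at the points `z i` are irrelevant. -/
def IsAdaptedConnection {k r : ℕ} (z : Fin k → ℂ) (m : Fin r → ℤ)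
    (α : Fin (k + 1) → Fin r → ℝ) (F : Fin (k + 1) → Fin r → Submodule ℂ (Fin r → ℂ))
    (A : ℂ → Matrix (Fin r) (Fin r) ℂ) : Prop :=
  ∃ (R : Fin (k + 1) → Matrix (Fin r) (Fin r) ℂ) (f₀ : ℂ → Matrix (Fin r) (Fin r) ℂ),
    MatEntire f₀ ∧
    (∀ w, (∀ i, w ≠ z i) → A w = (∑ i : Fin k, (w - z i)⁻¹ • R i.castSucc) + f₀ w) ∧
    HasPolarPart (formAtInfty m A) (R (Fin.last k)) ∧
    ∀ i, ResidueAdapted (R i) (α i) (F i)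

/-- An automorphism of `E_N`: a pair of holomorphic maps `g₀`, `g₁` into `GL(r, ℂ)`, on the affine
charts with coordinates `z` and `ζ = 1 / z`, such that `g₀ = z ^ N g₁ z ^ (-N)` on the overlap. -/
structure BundleAut {r : ℕ} (m : Fin r → ℤ) where
  g₀ : ℂ → Matrix (Fin r) (Fin r) ℂ
  g₁ : ℂ → Matrix (Fin r) (Fin r) ℂ
  entire₀ : MatEntire g₀
  entire₁ : MatEntire g₁
  isUnit₀ : ∀ z, IsUnit (g₀ z)
  isUnit₁ : ∀ ζ, IsUnit (g₁ ζ)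
  transition : ∀ z, z ≠ 0 → g₀ z = powN m z * g₁ z⁻¹ * powN m z⁻¹

/-- The gauge action `g · A = g A g⁻¹ - dg g⁻¹`, in the trivialization over `ℂ`. -/
def BundleAut.act {r : ℕ} {m : Fin r → ℤ} (g : BundleAut m)
    (A : ℂ → Matrix (Fin r) (Fin r) ℂ) (z : ℂ) : Matrix (Fin r) (Fin r) ℂ :=
  g.g₀ z * A z * (g.g₀ z)⁻¹ - matDeriv g.g₀ z * (g.g₀ z)⁻¹

/-- The parabolic group `P_N`: the invertible matrices that are block lower triangular for the
partition of the indices into the level sets of the nondecreasing sequence `m`. -/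
def parabolicGroup {r : ℕ} (m : Fin r → ℤ) : Set (Matrix (Fin r) (Fin r) ℂ) :=
  {P | IsUnit P ∧ ∀ j k, m j < m k → P j k = 0}

/-- The permutation matrix `Π` of `σ` (entries `Π j k = δ_{σ(j) k}`) represents the Bruhat class
in `W_N \ W(r)` of the flag `F`. If `F` is the image of the standard flag under `C`, this says
`C = P Π L` with `P ∈ P_N` and `L` unipotent lower triangular. It holds in particular when `F` lies
in the Bruhat cell of `Π`, that is, when one can take `P` unipotent lower triangular. -/
def IsBruhatRep {r : ℕ} (m : Fin r → ℤ) (F : Fin r → Submodule ℂ (Fin r → ℂ))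
    (σ : Equiv.Perm (Fin r)) : Prop :=
  ∃ P ∈ parabolicGroup m, F = flagAct (P * σ.permMatrix ℂ) (stdFlag r)

/-- In the frame over `ℂ` permuted by `Π`, the connection `A` expands near `∞` as
`((W + N') / ζ + holomorphic) dζ` with `N' = Ad(Π⁻¹)(N)`: the polar part at `∞` of `A` itself,
in the trivialization over `ℂ`, is `Ad(Π)(W + N')`. -/
def IsNormalizedAtInfty {r : ℕ} (m : Fin r → ℤ) (a : Fin r → ℝ) (σ : Equiv.Perm (Fin r))
    (A : ℂ → Matrix (Fin r) (Fin r) ℂ) : Prop :=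
  HasPolarPart (inZeta A)
    (matAd (σ.permMatrix ℂ) (weightW a + matAd (σ.permMatrix ℂ)⁻¹ (splitN m)))

end

/-! ### Complete flags, Bruhat representatives and block minors -/

section Flags

variable {r : ℕ}

/-! Everything happens at `∞`. Write `F_n = PΠ·F_r`. Since `F_n = B·F_r` as well, `B = PΠL` with `L`
lower triangular, and `Y₀ = BΠ⁻¹` diagonalizes the residue `R`, with the weights permuted by `σ`.
Weights lie in `[0, 1)`, so `R` is nonresonant and a polynomial gauge `Y(ζ) = Y₀ + ⋯` brings the
form at `∞` to `diag(a)/ζ` up to an error `ζ^T E` (`exists_approx_gauge`). Conjugating by `ζ^(-N)`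
passes to the frame over `ℂ`: the residue becomes `diag(a) + N`, and the error stays holomorphic
once `T` bounds all `m_j - m_k`.

It remains to replace the local gauge by a global one, that is, to find `g` with `ζ^(-N) g₁ Y ζ^N =
1 + O(ζ)`; such a factor does not change the residue. Each row of `g₁` solves a square linear
system, polynomials of degree at most `m_j - m_l` against congruences modulo `ζ^(m_j - m_k + 1)`
(`exists_bundleAut`). The system is triangular in the order of vanishing, and its diagonal blocks
are leading blocks of `Y₀ = P(ΠLΠ⁻¹)`, which `leading_block_nondegenerate` shows to be invertible.

For uniqueness, `q = h₀g₀⁻¹` is entire and meromorphic at `∞`. With `D = diag(a) + N` and `u` the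
coefficient of `q` at pole order `s`, one gets `Du = uD + su`. Diagonal entries of `D` differ by an
integer only on the diagonal, so there is no pole and `u` is diagonal; Liouville's theorem makes `q`
constant. -/

theorem mem_stdFlag {j : Fin r} {v : Fin r → ℂ} :
    v ∈ stdFlag r j ↔ ∀ l, l < j → v l = 0 := by
  constructor
  · intro hv l hl
    induction hv using Submodule.span_induction with
    | mem x hx =>
      obtain ⟨i, hi, rfl⟩ := hx
      exact Pi.single_eq_of_ne (hl.trans_le hi).ne 1
    | zero => rfl
    | add x y _ _ hx hy => simp [hx, hy]
    | smul a x _ hx => simp [hx]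
  · intro hv
    rw [pi_eq_sum_univ' v]
    refine Submodule.sum_mem _ fun i _ => ?_
    by_cases hi : i < j
    · simp [hv i hi]
    · refine Submodule.smul_mem _ _ (Submodule.subset_span ⟨i, not_lt.1 hi, ?_⟩)
      ext l
      simp [Pi.single_apply]

theorem flagAct_mul (A B : Matrix (Fin r) (Fin r) ℂ) (F : Fin r → Submodule ℂ (Fin r → ℂ)) :
    flagAct (A * B) F = flagAct A (flagAct B F) := by
  funext j
  simp only [flagAct, Matrix.mulVecLin_mul, Submodule.map_comp]

theorem flagAct_one (F : Fin r → Submodule ℂ (Fin r → ℂ)) : flagAct 1 F = F := by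
  funext j
  simp [flagAct]

theorem lower_of_flagAct_stdFlag {L : Matrix (Fin r) (Fin r) ℂ}
    (h : flagAct L (stdFlag r) = stdFlag r) {j k : Fin r} (hjk : j < k) : L j k = 0 := by
  have h1 : L.mulVecLin (Pi.single k 1) ∈ stdFlag r k := by
    rw [← congrFun h k]
    exact Submodule.mem_map_of_mem (Submodule.subset_span ⟨k, le_rfl, rfl⟩)
  simpa using mem_stdFlag.1 h1 j hjk

theorem flagAct_stdFlag_of_lower {L : Matrix (Fin r) (Fin r) ℂ} (hL : IsUnit L)
    (h : ∀ j k, j < k → L j k = 0) : flagAct L (stdFlag r) = stdFlag r := by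
  funext j
  refine Submodule.eq_of_le_of_finrank_eq ?_ ?_
  · rintro _ ⟨v, hv, rfl⟩
    refine mem_stdFlag.2 fun l hl => ?_
    simp only [Matrix.mulVecLin_apply, Matrix.mulVec, dotProduct]
    refine Finset.sum_eq_zero fun i _ => ?_
    by_cases hi : i < j
    · rw [mem_stdFlag.1 hv i hi, mul_zero]
    · rw [h l i (hl.trans_le (not_lt.1 hi)), zero_mul]
  · exact LinearEquiv.finrank_map_eq (LinearEquiv.ofBijective L.mulVecLin
      ⟨Matrix.mulVec_injective_iff_isUnit.2 hL, Matrix.mulVec_surjective_iff_isUnit.2 hL⟩) _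

theorem diag_ne_zero_of_lower {L : Matrix (Fin r) (Fin r) ℂ} (hL : IsUnit L)
    (h : ∀ j k, j < k → L j k = 0) (j : Fin r) : L j j ≠ 0 := by
  have h1 : L.det ≠ 0 := ((Matrix.isUnit_iff_isUnit_det L).1 hL).ne_zero
  rw [Matrix.det_of_isLowerTriangular L fun a b hab => h a b (by simpa using hab)] at h1
  exact Finset.prod_ne_zero_iff.1 h1 j (Finset.mem_univ j)

theorem isUnit_permMatrix (σ : Equiv.Perm (Fin r)) : IsUnit (σ.permMatrix ℂ) := by
  rw [Matrix.isUnit_iff_isUnit_det, Matrix.det_permutation]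
  rcases Int.units_eq_one_or (Equiv.Perm.sign σ) with h | h <;> simp [h]

theorem mul_permMatrix_apply (P : Matrix (Fin r) (Fin r) ℂ) (σ : Equiv.Perm (Fin r))
    (i j : Fin r) : (P * σ.permMatrix ℂ) i j = P i (σ.symm j) := by
  simp [Equiv.Perm.permMatrix, PEquiv.mul_toMatrix_toPEquiv]

theorem inv_permMatrix (σ : Equiv.Perm (Fin r)) :
    (σ.permMatrix ℂ)⁻¹ = (σ⁻¹).permMatrix ℂ := by
  refine Matrix.inv_eq_right_inv ?_
  rw [← Matrix.permMatrix_mul]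
  simp

/-- A column of `B`, corrected by later columns so that its first nonzero entry is as low
as possible. -/
theorem exists_maximal_lead {B : Matrix (Fin r) (Fin r) ℂ} (hB : IsUnit B) (j : Fin r) :
    ∃ (i : Fin r) (u : Fin r → ℂ), u j = 1 ∧ (∀ k, k < j → u k = 0) ∧
      (∀ l, l < i → B.mulVec u l = 0) ∧ B.mulVec u i ≠ 0 ∧
      ∀ u' : Fin r → ℂ, u' j = 1 → (∀ k, k < j → u' k = 0) →
        (∀ l, l < i → B.mulVec u' l = 0) → B.mulVec u' i ≠ 0 := by
  classical
  let Q : ℕ → Prop := fun i => ∃ u : Fin r → ℂ, u j = 1 ∧ (∀ k, k < j → u k = 0) ∧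
    ∀ l : Fin r, (l : ℕ) < i → B.mulVec u l = 0
  have h0 : Q 0 := ⟨Pi.single j 1, by simp, fun k hk => Pi.single_eq_of_ne hk.ne 1, by simp⟩
  have hr : ¬ Q r := by
    rintro ⟨u, hu, -, h⟩
    have h1 : B.mulVec u = B.mulVec 0 := by
      ext l
      simpa using h l l.2
    rw [Matrix.mulVec_injective_iff_isUnit.2 hB h1] at hu
    simp at hu
  have hex : ∃ i, Q i ∧ ¬ Q (i + 1) := by
    by_contra! hcon
    exact hr (Nat.rec h0 hcon r)
  obtain ⟨i, ⟨u, hu1, hu2, hu3⟩, hi⟩ := hex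
  have hir : i < r := by
    by_contra! hle
    exact hr ⟨u, hu1, hu2, fun l _ => hu3 l (l.2.trans_le hle)⟩
  have key : ∀ u' : Fin r → ℂ, u' j = 1 → (∀ k, k < j → u' k = 0) →
      (∀ l, l < (⟨i, hir⟩ : Fin r) → B.mulVec u' l = 0) → B.mulVec u' ⟨i, hir⟩ ≠ 0 := by
    intro u' h1 h2 h3 h4
    refine hi ⟨u', h1, h2, fun l hl => ?_⟩
    rcases (Nat.lt_succ_iff.1 hl).lt_or_eq with h | h
    · exact h3 l h
    · rw [show l = ⟨i, hir⟩ from Fin.ext h, h4]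
  exact ⟨⟨i, hir⟩, u, hu1, hu2, fun l hl => hu3 l hl, key u hu1 hu2 fun l hl => hu3 l hl, key⟩

/-- Bruhat decomposition for flags. -/
theorem exists_isBruhatRep {m : Fin r → ℤ} (hm : Monotone m) {B : Matrix (Fin r) (Fin r) ℂ}
    (hB : IsUnit B) : ∃ σ, IsBruhatRep m (flagAct B (stdFlag r)) σ := by
  choose τ u hu1 hu2 hu3 hu4 hu5 using exists_maximal_lead hB
  -- If two leading rows coincided, subtracting a multiple of the later column would push the lead
  -- of the earlier one further down, against maximality.
  have hlt : ∀ j j', j < j' → τ j ≠ τ j' := by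
    intro j j' hjj h
    set t := B.mulVec (u j) (τ j) / B.mulVec (u j') (τ j') with ht
    refine hu5 j (u j - t • u j') ?_ ?_ ?_ ?_
    · simp [hu1, hu2 j' j hjj]
    · intro k hk
      simp [hu2 j k hk, hu2 j' k (hk.trans hjj)]
    · intro l hl
      rw [Matrix.mulVec_sub, Matrix.mulVec_smul]
      simp [hu3 j l hl, hu3 j' l (h ▸ hl)]
    · rw [Matrix.mulVec_sub, Matrix.mulVec_smul, Pi.sub_apply, Pi.smul_apply, ht, h, smul_eq_mul,
        div_mul_cancel₀ _ (hu4 j'), sub_self]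
  have hinj : Function.Injective τ := by
    intro j j' h
    rcases lt_trichotomy j j' with h1 | h1 | h1
    · exact absurd h (hlt j j' h1)
    · exact h1
    · exact absurd h.symm (hlt j' j h1)
  let τe : Equiv.Perm (Fin r) := Equiv.ofBijective τ (Finite.injective_iff_bijective.1 hinj)
  let L : Matrix (Fin r) (Fin r) ℂ := Matrix.of fun k j => u j k
  have hL0 : ∀ j k, j < k → L j k = 0 := fun j k h => hu2 k j h
  have hLu : IsUnit L := by
    rw [Matrix.isUnit_iff_isUnit_det,
      Matrix.det_of_isLowerTriangular L fun a b hab => hL0 a b (by simpa using hab)]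
    simp [L, hu1]
  have hBL : ∀ l j, (B * L) l j = B.mulVec (u j) l := fun l j => rfl
  have hP : B * L * (τe.permMatrix ℂ) * τe⁻¹.permMatrix ℂ = B * L := by
    rw [mul_assoc, ← Matrix.permMatrix_mul]
    simp
  -- The permutation moves the column led by row `k` to position `k`, so the product is lower
  -- triangular, which for monotone `m` is stronger than block lower triangular.
  refine ⟨τe⁻¹, B * L * τe.permMatrix ℂ, ⟨(hB.mul hLu).mul (isUnit_permMatrix _), ?_⟩, ?_⟩
  · intro j k hjk
    rw [mul_permMatrix_apply, hBL]
    refine hu3 _ _ ?_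
    have : τ (τe.symm k) = k := τe.apply_symm_apply k
    rw [this]
    exact hm.reflect_lt hjk
  · rw [hP, flagAct_mul, flagAct_stdFlag_of_lower hLu hL0]

theorem exists_lower_of_flagAct_eq {B C : Matrix (Fin r) (Fin r) ℂ} (hB : IsUnit B)
    (hC : IsUnit C) (h : flagAct B (stdFlag r) = flagAct C (stdFlag r)) :
    ∃ L : Matrix (Fin r) (Fin r) ℂ, B = C * L ∧ (∀ j k, j < k → L j k = 0) ∧
      ∀ j, L j j ≠ 0 := by
  have hC' : IsUnit C⁻¹ := (Matrix.isUnit_nonsing_inv_iff).2 hC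
  have hd := (Matrix.isUnit_iff_isUnit_det C).1 hC
  have hl : ∀ j k, j < k → (C⁻¹ * B) j k = 0 := fun j k hjk => by
    refine lower_of_flagAct_stdFlag ?_ hjk
    rw [flagAct_mul, h, ← flagAct_mul, Matrix.nonsing_inv_mul C hd, flagAct_one]
  exact ⟨C⁻¹ * B, by rw [← mul_assoc, Matrix.mul_nonsing_inv C hd, one_mul], hl,
    diag_ne_zero_of_lower (hC'.mul hB) hl⟩

/-- The leading principal minors of `P Π L Π⁻¹` along the blocks of `m` do not vanish. -/
theorem leading_block_nondegenerate {m : Fin r → ℤ} {P L : Matrix (Fin r) (Fin r) ℂ}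
    (hP : P ∈ parabolicGroup m) (σ : Equiv.Perm (Fin r)) (hL : ∀ j k, j < k → L j k = 0)
    (hL' : ∀ j, L j j ≠ 0) (c : ℤ) (w : Fin r → ℂ) (hw : ∀ l, c < m l → w l = 0)
    (h : ∀ k, m k ≤ c →
      Matrix.vecMul w (P * σ.permMatrix ℂ * L * (σ.permMatrix ℂ)⁻¹) k = 0) : w = 0 := by
  set Q := σ.permMatrix ℂ * L * (σ.permMatrix ℂ)⁻¹ with hQ
  have hQe : ∀ i k, Q i k = L (σ i) (σ k) := by
    intro i k
    rw [hQ, inv_permMatrix, mul_permMatrix_apply]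
    simp [Equiv.Perm.permMatrix, PEquiv.toMatrix_toPEquiv_mul, ← Equiv.Perm.inv_def]
  set u := Matrix.vecMul w P with hu
  have hu0 : ∀ k, c < m k → u k = 0 := by
    intro k hk
    simp only [hu, Matrix.vecMul, dotProduct]
    refine Finset.sum_eq_zero fun l _ => ?_
    by_cases hl : c < m l
    · rw [hw l hl, zero_mul]
    · rw [hP.2 l k ((not_lt.1 hl).trans_lt hk), mul_zero]
  have huQ : ∀ k, m k ≤ c → ∑ l, u l * L (σ l) (σ k) = 0 := by
    intro k hk
    have h1 := h k hk
    rw [mul_assoc, mul_assoc, ← mul_assoc (σ.permMatrix ℂ), ← hQ, ← Matrix.vecMul_vecMul,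
      ← hu] at h1
    simpa only [Matrix.vecMul, dotProduct, hQe] using h1
  -- Among the indices with `u k ≠ 0`, take the one with `σ k` largest: by triangularity of `L`, the
  -- equation for column `k` reduces to `u k * L (σ k) (σ k) = 0`.
  have hu1 : u = 0 := by
    by_contra hne
    have hs : (Finset.univ.filter fun k => u k ≠ 0).Nonempty := by
      obtain ⟨k, hk⟩ := Function.ne_iff.1 hne
      exact ⟨k, by simpa using hk⟩
    obtain ⟨k, hk, hmax⟩ := Finset.exists_max_image _ σ hs
    have hk' : u k ≠ 0 := by simpa using hk
    have hkc : m k ≤ c := by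
      by_contra! hlt
      exact hk' (hu0 k hlt)
    have h1 := huQ k hkc
    rw [Finset.sum_eq_single k] at h1
    · exact (mul_ne_zero hk' (hL' _)) h1
    · intro l _ hlk
      by_cases hl : u l = 0
      · rw [hl, zero_mul]
      · have h2 : σ l ≤ σ k := hmax l (by simpa using hl)
        rw [hL _ _ (lt_of_le_of_ne h2 fun he => hlk (σ.injective he)), mul_zero]
    · simp
  have hinj := Matrix.vecMul_injective_iff_isUnit.2 hP.1
  exact hinj (by simp only [← hu, hu1, Matrix.zero_vecMul])

end Flags

/-! ### Automorphisms of the split bundle with a prescribed jet at infinity -/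

section Splitting

open Polynomial

variable {r : ℕ}

theorem mem_degreeLT_sum {d : ℕ} (c : Fin d → ℂ) :
    ∑ s : Fin d, C (c s) * X ^ (s : ℕ) ∈ degreeLT ℂ d := by
  refine Submodule.sum_mem _ fun s _ => mem_degreeLT.2 ?_
  exact (degree_C_mul_X_pow_le _ _).trans_lt (by exact_mod_cast s.2)

theorem coeff_sum_fin {d : ℕ} (c : Fin d → ℂ) (s : Fin d) :
    (∑ t : Fin d, C (c t) * X ^ (t : ℕ)).coeff s = c s := by
  simp [coeff_X_pow, Fin.val_inj]

/-- A square system of linear equations for the coefficients of a row of polynomials. -/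
theorem exists_polynomial_row (d : Fin r → ℕ) (Y : Matrix (Fin r) (Fin r) ℂ[X])
    (hY : ∀ (s : ℕ) (w : Fin r → ℂ), (∀ l, d l ≤ s → w l = 0) →
      (∀ k, s < d k → ∑ l, w l * (Y l k).coeff 0 = 0) → w = 0) (t : Fin r → ℂ[X]) :
    ∃ v : Fin r → ℂ[X], (∀ l, v l ∈ degreeLT ℂ (d l)) ∧
      ∀ k, X ^ d k ∣ ∑ l, v l * Y l k - t k := by
  let p : ((l : Fin r) → Fin (d l) → ℂ) → Fin r → ℂ[X] :=
    fun c l => ∑ s : Fin (d l), C (c l s) * X ^ (s : ℕ)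
  let T : ((l : Fin r) → Fin (d l) → ℂ) →ₗ[ℂ] ((l : Fin r) → Fin (d l) → ℂ) :=
    { toFun := fun c k s => (∑ l, p c l * Y l k).coeff s
      map_add' := by
        intro a b
        funext k s
        simp [p, add_mul, Finset.sum_add_distrib]
      map_smul' := by
        intro a b
        funext k s
        have : ∀ l, p (a • b) l = C a * p b l := fun l => by
          simp [p, Finset.mul_sum, mul_assoc]
        simp only [this, mul_assoc, ← Finset.mul_sum, coeff_C_mul]
        rfl }
  -- Unknowns and equations form the same finite-dimensional space, so injectivity gives
  -- solvability. Once the coefficients below order `s` vanish, the equations of order `s` involve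
  -- only the constant terms of `Y`, which is where `hY` applies.
  have hT : Function.Injective T := by
    rw [← LinearMap.ker_eq_bot, LinearMap.ker_eq_bot']
    intro c hc
    have key : ∀ s l, (p c l).coeff s = 0 := by
      intro s
      induction s using Nat.strong_induction_on with
      | _ s ih =>
        intro l
        have h1 := hY s (fun l => (p c l).coeff s) (fun l hl => ?_) (fun k hk => ?_)
        · exact congrFun h1 l
        · exact coeff_eq_zero_of_degree_lt
            ((mem_degreeLT.1 (mem_degreeLT_sum (c l))).trans_le (by exact_mod_cast hl))
        · have h2 : (∑ l, p c l * Y l k).coeff s = 0 := congrFun (congrFun hc k) ⟨s, hk⟩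
          rw [← h2, finsetSum_coeff]
          refine Finset.sum_congr rfl fun l _ => ?_
          rw [coeff_mul, Finset.sum_eq_single (s, 0)]
          · rintro ⟨a, b⟩ hab hne
            replace hab : a + b = s := by simpa using hab
            have : a < s := by
              rcases Nat.eq_zero_or_pos b with hb | hb
              · subst hb
                exact absurd (by simpa using hab) (by simpa using hne)
              · omega
            simp only [ih a this l, zero_mul]
          · simp
    funext l s
    have := key s l
    rwa [coeff_sum_fin] at this
  obtain ⟨c, hc⟩ := LinearMap.injective_iff_surjective.1 hT fun k s => (t k).coeff s
  refine ⟨p c, fun l => mem_degreeLT_sum (c l), fun k => X_pow_dvd_iff.2 fun s hs => ?_⟩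
  rw [coeff_sub, sub_eq_zero]
  exact congrFun (congrFun hc k) ⟨s, hs⟩

theorem MatEntire.det {f : ℂ → Matrix (Fin r) (Fin r) ℂ} (hf : MatEntire f) :
    Differentiable ℂ fun z => (f z).det := by
  simp only [Matrix.det_apply]
  refine Differentiable.fun_sum fun σ _ => ?_
  exact (Differentiable.fun_finsetProd fun i _ => hf _ _).const_smul _

theorem powN_mul_powN_inv (m : Fin r → ℤ) {z : ℂ} (hz : z ≠ 0) :
    powN m z * powN m z⁻¹ = 1 := by
  simp only [powN, Matrix.diagonal_mul_diagonal]
  rw [← Matrix.diagonal_one]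
  congr 1
  funext j
  rw [inv_zpow, mul_inv_cancel₀ (zpow_ne_zero _ hz)]

theorem powN_inv_mul_powN (m : Fin r → ℤ) {z : ℂ} (hz : z ≠ 0) :
    powN m z⁻¹ * powN m z = 1 := by
  have := powN_mul_powN_inv m (inv_ne_zero hz)
  rwa [inv_inv] at this

/-- An entire function with a limit at infinity, read in the coordinate `1 / z`, is constant. -/
theorem eq_of_tendsto_inv {f : ℂ → ℂ} (hf : Differentiable ℂ f) {c : ℂ}
    (h : Tendsto (fun ζ => f ζ⁻¹) (𝓝[≠] 0) (𝓝 c)) (z : ℂ) : f z = c := by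
  refine hf.apply_eq_of_tendsto_cocompact z ?_
  rw [← Metric.cobounded_eq_cocompact]
  have := h.comp (tendsto_inv₀_cobounded' (α := ℂ))
  simpa [Function.comp_def] using this

theorem det_transition {m : Fin r → ℤ} {g₀ g₁ : ℂ → Matrix (Fin r) (Fin r) ℂ}
    (h : ∀ z, z ≠ 0 → g₀ z = powN m z * g₁ z⁻¹ * powN m z⁻¹) {z : ℂ} (hz : z ≠ 0) :
    (g₀ z).det = (g₁ z⁻¹).det := by
  rw [h z hz, Matrix.det_mul, Matrix.det_mul, mul_right_comm, ← Matrix.det_mul,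
    powN_mul_powN_inv m hz, Matrix.det_one, one_mul]

/-- Conjugation by `z^N` preserves determinants, so `det g₀` has a limit at `∞` and Liouville's
theorem applies. Invertibility at one point then gives it everywhere. -/
theorem det_eq_of_transition {m : Fin r → ℤ} {g₀ g₁ : ℂ → Matrix (Fin r) (Fin r) ℂ}
    (h₀ : MatEntire g₀) (h₁ : MatEntire g₁)
    (h : ∀ z, z ≠ 0 → g₀ z = powN m z * g₁ z⁻¹ * powN m z⁻¹) (z : ℂ) :
    (g₀ z).det = (g₁ 0).det := by
  refine eq_of_tendsto_inv h₀.det ?_ z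
  have h2 : Tendsto (fun ζ => (g₁ ζ).det) (𝓝[≠] 0) (𝓝 (g₁ 0).det) :=
    (h₁.det.continuous.tendsto 0).mono_left nhdsWithin_le_nhds
  refine h2.congr' ?_
  filter_upwards [self_mem_nhdsWithin] with ζ hζ
  rw [det_transition h (inv_ne_zero hζ), inv_inv]

/-- An entry of an automorphism is a section of `O(a - b)`: a polynomial of degree at most `a - b`
in either chart, with reversed coefficients. For `a < b` the truncated bound is `0`, which forces `v
= 0`. -/
theorem reflect_eval_transition {a b : ℤ} {v : ℂ[X]} (hv : v ∈ degreeLT ℂ (a - b + 1).toNat)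
    {z : ℂ} (hz : z ≠ 0) :
    (reflect (a - b).toNat v).eval z = z ^ a * v.eval z⁻¹ * z⁻¹ ^ b := by
  by_cases hab : a < b
  · have h0 : v = 0 := by
      rw [mem_degreeLT, show (a - b + 1).toNat = 0 by omega] at hv
      simpa using hv
    simp [h0]
  · have hd : v.natDegree ≤ (a - b).toNat := by
      by_cases h0 : v = 0
      · simp [h0]
      · have := (natDegree_lt_iff_degree_lt h0).2 (mem_degreeLT.1 hv)
        omega
    let _ : Invertible z⁻¹ := invertibleOfNonzero (inv_ne_zero hz)
    have h1 := eval₂_reflect_mul_pow (RingHom.id ℂ) z⁻¹ (a - b).toNat v hd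
    rw [← eval, ← eval, invOf_eq_inv, inv_inv] at h1
    rw [← h1]
    have h2 : z ^ a * z⁻¹ ^ b = z ^ (a - b).toNat := by
      rw [inv_zpow', ← zpow_add₀ hz, ← zpow_natCast]
      congr 1
      omega
    calc _ = eval z (reflect (a - b).toNat v) * (z⁻¹ ^ (a - b).toNat * z ^ (a - b).toNat) := by
          rw [inv_pow, inv_mul_cancel₀ (pow_ne_zero _ hz), mul_one]
      _ = _ := by rw [← h2]; ring

/-- The automorphism of `E_N` that brings a given jet of a gauge transformation at infinity
into the form `1 + O(ζ)` in the trivialization over `ℂ`. -/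
theorem exists_bundleAut (m : Fin r → ℤ) (Y : Matrix (Fin r) (Fin r) ℂ[X])
    (hY : ∀ (c : ℤ) (w : Fin r → ℂ), (∀ l, c < m l → w l = 0) →
      (∀ k, m k ≤ c → Matrix.vecMul w (Y.map (eval 0)) k = 0) → w = 0) :
    ∃ (g : BundleAut m) (H : Matrix (Fin r) (Fin r) ℂ[X]), ∀ ζ, ζ ≠ 0 →
      powN m ζ⁻¹ * g.g₁ ζ * Y.map (eval ζ) * powN m ζ = 1 + ζ • H.map (eval ζ) := by
  -- Conjugation multiplies entry `(j, k)` by `ζ^(m_k - m_j)`, so agreement with `1` up to `O(ζ)`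
  -- afterwards amounts to a congruence modulo `ζ^(m_j - m_k + 1)` before. At order `s` the relevant
  -- block is the one cut out by `c = m j - s`.
  have hrow : ∀ j, ∃ v : Fin r → ℂ[X], (∀ l, v l ∈ degreeLT ℂ (m j - m l + 1).toNat) ∧
      ∀ k, X ^ (m j - m k + 1).toNat ∣ ∑ l, v l * Y l k - (1 : Matrix (Fin r) (Fin r) ℂ[X]) j k := by
    intro j
    refine exists_polynomial_row _ Y (fun s w hw1 hw2 => ?_) _
    refine hY (m j - s) w (fun l hl => hw1 l (by omega)) fun k hk => ?_
    simpa [Matrix.vecMul, dotProduct, coeff_zero_eq_eval_zero] using hw2 k (by omega)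
  choose v hv hdvd using hrow
  choose p hp using hdvd
  let g₁ : ℂ → Matrix (Fin r) (Fin r) ℂ := fun ζ => Matrix.of fun j l => (v j l).eval ζ
  let g₀ : ℂ → Matrix (Fin r) (Fin r) ℂ := fun z =>
    Matrix.of fun j l => (reflect (m j - m l).toNat (v j l)).eval z
  have e₀ : MatEntire g₀ := fun j l => (reflect (m j - m l).toNat (v j l)).differentiable
  have e₁ : MatEntire g₁ := fun j l => (v j l).differentiable
  have ht : ∀ z, z ≠ 0 → g₀ z = powN m z * g₁ z⁻¹ * powN m z⁻¹ := by
    intro z hz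
    ext j l
    rw [powN, powN, Matrix.mul_diagonal, Matrix.diagonal_mul]
    exact reflect_eval_transition (hv j l) hz
  -- The integer exponent is never negative: it is `0` if `m k ≤ m j + 1` and `m k - m j - 1`
  -- otherwise, so `toNat` loses nothing.
  let H : Matrix (Fin r) (Fin r) ℂ[X] := Matrix.of fun j k =>
    X ^ (m k - m j + (m j - m k + 1).toNat - 1).toNat * p j k
  have hH : ∀ ζ, ζ ≠ 0 →
      powN m ζ⁻¹ * g₁ ζ * Y.map (eval ζ) * powN m ζ = 1 + ζ • H.map (eval ζ) := by
    intro ζ hζ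
    ext j k
    rw [powN, powN, Matrix.mul_diagonal, mul_assoc, Matrix.diagonal_mul]
    have h1 : (g₁ ζ * Y.map (eval ζ)) j k
        = (1 : Matrix (Fin r) (Fin r) ℂ) j k + ζ ^ (m j - m k + 1).toNat * (p j k).eval ζ := by
      have h2 := congrArg (eval ζ) (hp j k)
      rw [eval_sub, eval_finsetSum, sub_eq_iff_eq_add'] at h2
      simp only [eval_mul, eval_pow, eval_X] at h2
      rw [Matrix.mul_apply]
      simp only [g₁, Matrix.of_apply, Matrix.map_apply]
      rw [h2]
      congr 1
      by_cases hjk : j = k <;> simp [Matrix.one_apply, hjk]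
    rw [h1, Matrix.add_apply, Matrix.smul_apply, Matrix.map_apply, mul_add, add_mul]
    congr 1
    · by_cases hjk : j = k
      · subst hjk
        rw [Matrix.one_apply_eq, mul_one, inv_zpow, inv_mul_cancel₀ (zpow_ne_zero _ hζ)]
      · simp [hjk]
    · simp only [H, Matrix.of_apply, eval_mul, eval_pow, eval_X, smul_eq_mul]
      have h3 : ζ⁻¹ ^ m j * ζ ^ (m j - m k + 1).toNat * ζ ^ m k
          = ζ * ζ ^ (m k - m j + (m j - m k + 1).toNat - 1).toNat := by
        rw [inv_zpow', ← zpow_natCast, ← zpow_natCast, ← zpow_add₀ hζ, ← zpow_add₀ hζ,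
          ← zpow_one_add₀ hζ]
        congr 1
        omega
      calc _ = (ζ⁻¹ ^ m j * ζ ^ (m j - m k + 1).toNat * ζ ^ m k) * (p j k).eval ζ := by ring
        _ = _ := by rw [h3]; ring
  -- If it vanished, `det g₁` would vanish identically, hence so would `det (1 + ζH)` for `ζ ≠ 0`,
  -- whose limit at `0` is `1`.
  have hdet : (g₁ 0).det ≠ 0 := by
    intro h0
    have h1 : ∀ ζ, ζ ≠ 0 → (1 + ζ • H.map (eval ζ)).det = 0 := by
      intro ζ hζ
      have h2 := det_transition ht (inv_ne_zero hζ)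
      rw [inv_inv, det_eq_of_transition e₀ e₁ ht, h0] at h2
      rw [← hH ζ hζ, Matrix.det_mul, Matrix.det_mul, Matrix.det_mul, ← h2]
      ring
    have hK : MatEntire fun ζ : ℂ => 1 + ζ • H.map (eval ζ) := fun j k => by
      simp only [Matrix.add_apply, Matrix.smul_apply, Matrix.map_apply]
      exact (differentiable_const _).add (differentiable_id.smul (H j k).differentiable)
    have h3 : Tendsto (fun ζ : ℂ => (1 + ζ • H.map (eval ζ)).det) (𝓝[≠] 0)
        (𝓝 (1 + (0 : ℂ) • H.map (eval 0)).det) :=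
      (hK.det.continuous.tendsto 0).mono_left nhdsWithin_le_nhds
    have h4 : Tendsto (fun ζ : ℂ => (1 + ζ • H.map (eval ζ)).det) (𝓝[≠] 0) (𝓝 0) := by
      refine tendsto_const_nhds.congr' ?_
      filter_upwards [self_mem_nhdsWithin] with ζ hζ
      exact (h1 ζ hζ).symm
    have h5 := tendsto_nhds_unique h3 h4
    simp at h5
  refine ⟨⟨g₀, g₁, e₀, e₁, fun z => ?_, fun z => ?_, ht⟩, H, hH⟩
  · rw [Matrix.isUnit_iff_isUnit_det, det_eq_of_transition e₀ e₁ ht]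
    exact hdet.isUnit
  · rw [Matrix.isUnit_iff_isUnit_det]
    by_cases hz : z = 0
    · rw [hz]; exact hdet.isUnit
    · have h2 := det_transition ht (inv_ne_zero hz)
      rw [inv_inv, det_eq_of_transition e₀ e₁ ht] at h2
      rw [← h2]
      exact hdet.isUnit

end Splitting

/-! ### Matrix calculus and gauge transformations near infinity -/

section Gauge

variable {r : ℕ}

/-- The entries of a matrix-valued function are holomorphic at `0`. -/
def MatAnalytic (f : ℂ → Matrix (Fin r) (Fin r) ℂ) : Prop :=
  ∀ j k, AnalyticAt ℂ (fun ζ => f ζ j k) 0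

/-- The entrywise derivative at a point. -/
def MatHasDerivAt (f : ℂ → Matrix (Fin r) (Fin r) ℂ) (f' : Matrix (Fin r) (Fin r) ℂ)
    (z : ℂ) : Prop :=
  ∀ j k, HasDerivAt (fun w => f w j k) (f' j k) z

namespace MatAnalytic

variable {f g : ℂ → Matrix (Fin r) (Fin r) ℂ}

theorem add (hf : MatAnalytic f) (hg : MatAnalytic g) : MatAnalytic fun ζ => f ζ + g ζ :=
  fun j k => (hf j k).fun_add (hg j k)

theorem sub (hf : MatAnalytic f) (hg : MatAnalytic g) : MatAnalytic fun ζ => f ζ - g ζ :=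
  fun j k => (hf j k).fun_sub (hg j k)

theorem mul (hf : MatAnalytic f) (hg : MatAnalytic g) : MatAnalytic fun ζ => f ζ * g ζ := by
  intro j k
  simp only [Matrix.mul_apply]
  exact Finset.analyticAt_fun_sum _ fun i _ => (hf j i).fun_mul (hg i k)

theorem const (M : Matrix (Fin r) (Fin r) ℂ) : MatAnalytic fun _ => M :=
  fun _ _ => analyticAt_const

theorem smul {c : ℂ → ℂ} (hc : AnalyticAt ℂ c 0) (hf : MatAnalytic f) :
    MatAnalytic fun ζ => c ζ • f ζ :=
  fun j k => hc.fun_smul (hf j k)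

theorem det (hf : MatAnalytic f) : AnalyticAt ℂ (fun ζ => (f ζ).det) 0 := by
  simp only [Matrix.det_apply]
  refine Finset.analyticAt_fun_sum _ fun σ _ => ?_
  exact (Finset.analyticAt_fun_prod _ fun i _ => hf _ _).const_smul

theorem inv (hf : MatAnalytic f) (h0 : (f 0).det ≠ 0) : MatAnalytic fun ζ => (f ζ)⁻¹ := by
  intro j k
  simp only [Matrix.inv_def, Ring.inverse_eq_inv', Matrix.smul_apply, Matrix.adjugate_apply]
  refine (hf.det.fun_inv h0).fun_smul (MatAnalytic.det fun a b => ?_)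
  by_cases h : a = k
  · subst h
    simpa using analyticAt_const
  · simpa [Matrix.updateRow_ne h] using hf a b

theorem eval (P : Matrix (Fin r) (Fin r) (Polynomial ℂ)) :
    MatAnalytic fun ζ => P.map (Polynomial.eval ζ) :=
  fun j k => (P j k).differentiable.analyticAt 0

theorem matDeriv (hf : MatAnalytic f) : MatAnalytic (matDeriv f) :=
  fun j k => (hf j k).deriv

theorem eq_at_zero (hf : MatAnalytic f) (hg : MatAnalytic g)
    (h : ∀ᶠ ζ in 𝓝[≠] (0 : ℂ), f ζ = g ζ) : f 0 = g 0 := by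
  ext j k
  have h1 := ((hf j k).continuousAt.tendsto).mono_left (nhdsWithin_le_nhds (s := {0}ᶜ))
  have h2 := ((hg j k).continuousAt.tendsto).mono_left (nhdsWithin_le_nhds (s := {0}ᶜ))
  exact tendsto_nhds_unique h1 (h2.congr' (h.mono fun ζ hζ => by simp only [hζ]))

theorem eventually_matHasDerivAt (hf : MatAnalytic f) :
    ∀ᶠ ζ in 𝓝 (0 : ℂ), MatHasDerivAt f (_root_.matDeriv f ζ) ζ := by
  simp only [MatHasDerivAt, eventually_all]
  intro j k
  filter_upwards [(hf j k).eventually_analyticAt] with ζ hζ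
  exact hζ.differentiableAt.hasDerivAt

theorem exists_slope (hf : MatAnalytic f) :
    ∃ g, MatAnalytic g ∧ ∀ ζ, f ζ = f 0 + ζ • g ζ := by
  refine ⟨fun ζ => Matrix.of fun j k => dslope (fun w => f w j k) 0 ζ, fun j k => ?_,
    fun ζ => ?_⟩
  · obtain ⟨p, hp⟩ := hf j k
    exact ⟨_, hp.has_fpower_series_dslope_fslope⟩
  · ext j k
    have := sub_smul_dslope (fun w => f w j k) 0 ζ
    simp only [sub_zero, smul_eq_mul] at this
    simp only [Matrix.add_apply, Matrix.smul_apply, Matrix.of_apply, smul_eq_mul]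
    linear_combination -this

end MatAnalytic

theorem MatEntire.matAnalytic {f : ℂ → Matrix (Fin r) (Fin r) ℂ} (hf : MatEntire f) :
    MatAnalytic f :=
  fun j k => (hf j k).analyticAt 0

theorem MatEntire.mul {f g : ℂ → Matrix (Fin r) (Fin r) ℂ} (hf : MatEntire f)
    (hg : MatEntire g) : MatEntire fun z => f z * g z := by
  intro j k
  simp only [Matrix.mul_apply]
  exact Differentiable.fun_sum fun i _ => (hf j i).mul (hg i k)

theorem MatEntire.inv {f : ℂ → Matrix (Fin r) (Fin r) ℂ} (hf : MatEntire f)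
    (h : ∀ z, IsUnit (f z)) : MatEntire fun z => (f z)⁻¹ := by
  intro j k
  simp only [Matrix.inv_def, Ring.inverse_eq_inv', Matrix.smul_apply, Matrix.adjugate_apply]
  refine (hf.det.fun_inv fun z => ((Matrix.isUnit_iff_isUnit_det _).1 (h z)).ne_zero).fun_smul
    (MatEntire.det fun a b => ?_)
  by_cases hab : a = k
  · subst hab
    simp
  · simpa [Matrix.updateRow_ne hab] using hf a b

theorem MatEntire.matHasDerivAt_comp_inv {f : ℂ → Matrix (Fin r) (Fin r) ℂ} (hf : MatEntire f)
    {ζ : ℂ} (hζ : ζ ≠ 0) :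
    MatHasDerivAt (fun w => f w⁻¹) (-((ζ ^ 2)⁻¹ • matDeriv f ζ⁻¹)) ζ := by
  intro j k
  have h := ((hf j k).differentiableAt (x := ζ⁻¹)).hasDerivAt.comp ζ (hasDerivAt_inv hζ)
  refine h.congr_deriv ?_
  simp [matDeriv, mul_comm]

theorem MatHasDerivAt.mul {f g : ℂ → Matrix (Fin r) (Fin r) ℂ}
    {f' g' : Matrix (Fin r) (Fin r) ℂ} {z : ℂ} (hf : MatHasDerivAt f f' z)
    (hg : MatHasDerivAt g g' z) :
    MatHasDerivAt (fun w => f w * g w) (f' * g z + f z * g') z := by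
  intro j k
  simp only [Matrix.mul_apply, Matrix.add_apply, ← Finset.sum_add_distrib]
  exact HasDerivAt.fun_sum fun i _ => (hf j i).fun_mul (hg i k)

theorem MatHasDerivAt.smul {c : ℂ → ℂ} {c' : ℂ} {f : ℂ → Matrix (Fin r) (Fin r) ℂ}
    {f' : Matrix (Fin r) (Fin r) ℂ} {z : ℂ} (hc : HasDerivAt c c' z) (hf : MatHasDerivAt f f' z) :
    MatHasDerivAt (fun w => c w • f w) (c' • f z + c z • f') z := by
  intro j k
  refine (hc.fun_smul (hf j k)).congr_deriv ?_
  simp [add_comm]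

theorem MatHasDerivAt.unique {f g : ℂ → Matrix (Fin r) (Fin r) ℂ}
    {f' g' : Matrix (Fin r) (Fin r) ℂ} {z : ℂ} (hf : MatHasDerivAt f f' z)
    (hg : MatHasDerivAt g g' z) (h : ∀ᶠ w in 𝓝 z, f w = g w) : f' = g' := by
  ext j k
  exact (hf j k).unique ((hg j k).congr_of_eventuallyEq (h.mono fun w hw => by simp only [hw]))

/-- A polynomial gauge transformation bringing a nonresonant logarithmic connection into its
normal form up to a given order. -/
theorem exists_approx_gauge {f : ℂ → Matrix (Fin r) (Fin r) ℂ} (hf : MatAnalytic f)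
    {R Y₀ : Matrix (Fin r) (Fin r) ℂ} {μ : Fin r → ℂ} (hY₀ : IsUnit Y₀)
    (hR : R * Y₀ = Y₀ * Matrix.diagonal μ) (hμ : ∀ j k, ∀ s : ℕ, μ j - μ k + (s + 1) ≠ 0)
    (T : ℕ) : ∃ Y : Matrix (Fin r) (Fin r) (Polynomial ℂ), Y.map (Polynomial.eval 0) = Y₀ ∧
      ∃ E, MatAnalytic E ∧ ∀ ζ, ζ ≠ 0 →
        (ζ⁻¹ • R + f ζ) * Y.map (Polynomial.eval ζ)
          + Y.map (fun p => (Polynomial.derivative p).eval ζ)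
        = ζ⁻¹ • (Y.map (Polynomial.eval ζ) * Matrix.diagonal μ) + ζ ^ T • E ζ := by
  induction T with
  | zero =>
    have h1 : ∀ ζ, (Y₀.map Polynomial.C).map (Polynomial.eval ζ) = Y₀ := fun ζ => by
      ext; simp
    refine ⟨Y₀.map Polynomial.C, h1 0, fun ζ => f ζ * Y₀, hf.mul (.const _), fun ζ hζ => ?_⟩
    have h2 : (Y₀.map Polynomial.C).map (fun p => (Polynomial.derivative p).eval ζ) = 0 := by
      ext; simp
    rw [h1, h2, add_mul, smul_mul_assoc, hR, add_zero, pow_zero, one_smul]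
  | succ T ih =>
    obtain ⟨Y, hY, E, hE, hYE⟩ := ih
    obtain ⟨E', hE', hEE'⟩ := hE.exists_slope
    have hd := (Matrix.isUnit_iff_isUnit_det _).1 hY₀
    -- A correction `ζ^(T+1) x` cancels the error term `E 0` when `Rx + (T+1)x - x diag(μ) = -E 0`.
    -- In the eigenbasis `Y₀` this decouples into scalar equations, and nonresonance makes the
    -- divisors nonzero.
    let x' : Matrix (Fin r) (Fin r) ℂ :=
      Matrix.of fun j k => -(Y₀⁻¹ * E 0) j k / (μ j - μ k + (T + 1))
    let x := Y₀ * x'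
    have hx' : Matrix.diagonal μ * x' + ((T : ℂ) + 1) • x' - x' * Matrix.diagonal μ
        = -(Y₀⁻¹ * E 0) := by
      ext j k
      simp only [x', Matrix.sub_apply, Matrix.add_apply, Matrix.smul_apply, Matrix.diagonal_mul,
        Matrix.mul_diagonal, Matrix.of_apply, Matrix.neg_apply, smul_eq_mul]
      have := hμ j k T
      field_simp
      ring
    have hx : R * x + ((T : ℂ) + 1) • x - x * Matrix.diagonal μ = -E 0 := by
      have h1 := congrArg (Y₀ * ·) hx'
      simp only [mul_sub, mul_add, mul_neg, mul_smul_comm, ← mul_assoc,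
        Matrix.mul_nonsing_inv _ hd, one_mul] at h1
      rw [← h1]
      simp only [x, ← mul_assoc, hR]
    let Y' : Matrix (Fin r) (Fin r) (Polynomial ℂ) :=
      Matrix.of fun j k => Y j k + Polynomial.X ^ (T + 1) * Polynomial.C (x j k)
    have e1 : ∀ ζ, Y'.map (Polynomial.eval ζ) = Y.map (Polynomial.eval ζ) + ζ ^ (T + 1) • x := by
      intro ζ; ext; simp [Y']; ring
    have e2 : ∀ ζ, Y'.map (fun p => (Polynomial.derivative p).eval ζ)
        = Y.map (fun p => (Polynomial.derivative p).eval ζ) + (((T : ℂ) + 1) * ζ ^ T) • x := by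
      intro ζ; ext; simp [Y']; ring
    refine ⟨Y', by rw [e1, hY]; simp, fun ζ => E' ζ + f ζ * x,
      hE'.add (hf.mul (.const _)), fun ζ hζ => ?_⟩
    have h1 := hYE ζ hζ
    rw [hEE' ζ] at h1
    rw [e1, e2]
    simp only [add_mul, mul_add, smul_mul_assoc, mul_smul_comm] at h1 ⊢
    linear_combination (norm := skip) h1 + ζ ^ T • hx
    all_goals match_scalars <;> field_simp <;> ring

/-- The gauge law in the coordinate `ζ`, cleared of inverses; the last term is the derivative of
`g₀(1/ζ)` where `ζ ≠ 0`. -/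
theorem inZeta_act_mul {m : Fin r → ℤ} (g : BundleAut m) (A : ℂ → Matrix (Fin r) (Fin r) ℂ)
    (ζ : ℂ) : inZeta (g.act A) ζ * g.g₀ ζ⁻¹
      = g.g₀ ζ⁻¹ * inZeta A ζ - -((ζ ^ 2)⁻¹ • matDeriv g.g₀ ζ⁻¹) := by
  have hd := (Matrix.isUnit_iff_isUnit_det _).1 (g.isUnit₀ ζ⁻¹)
  simp only [inZeta, BundleAut.act, neg_mul, mul_neg, smul_mul_assoc, mul_smul_comm, sub_mul,
    mul_assoc, Matrix.nonsing_inv_mul _ hd, mul_one, smul_sub]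
  abel

theorem BundleAut.g₀_inv_eq {m : Fin r → ℤ} (g : BundleAut m) {ζ : ℂ} (hζ : ζ ≠ 0) :
    g.g₀ ζ⁻¹ = powN m ζ⁻¹ * g.g₁ ζ * powN m ζ := by
  rw [g.transition _ (inv_ne_zero hζ), inv_inv]

theorem powN_mul_splitN (m : Fin r → ℤ) (ζ : ℂ) :
    powN m ζ * splitN m = splitN m * powN m ζ := by
  simp only [powN, splitN, Matrix.diagonal_mul_diagonal, mul_comm]

theorem inZeta_eq (m : Fin r → ℤ) (A : ℂ → Matrix (Fin r) (Fin r) ℂ) {ζ : ℂ} (hζ : ζ ≠ 0) :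
    inZeta A ζ = powN m ζ⁻¹ * (formAtInfty m A ζ + ζ⁻¹ • splitN m) * powN m ζ := by
  rw [formAtInfty, sub_add_cancel]
  calc inZeta A ζ = (powN m ζ⁻¹ * powN m ζ) * inZeta A ζ * (powN m ζ⁻¹ * powN m ζ) := by
        rw [powN_inv_mul_powN m hζ, one_mul, mul_one]
    _ = _ := by simp only [mul_assoc]

theorem matHasDerivAt_conj_powN (m : Fin r → ℤ) {f : ℂ → Matrix (Fin r) (Fin r) ℂ}
    {f' : Matrix (Fin r) (Fin r) ℂ} {ζ : ℂ} (hζ : ζ ≠ 0) (hf : MatHasDerivAt f f' ζ) :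
    MatHasDerivAt (fun w => powN m w⁻¹ * f w * powN m w)
      (ζ⁻¹ • (powN m ζ⁻¹ * f ζ * powN m ζ * splitN m - splitN m * (powN m ζ⁻¹ * f ζ * powN m ζ))
        + powN m ζ⁻¹ * f' * powN m ζ) ζ := by
  intro j k
  simp only [powN, splitN, Matrix.mul_diagonal, Matrix.diagonal_mul, Matrix.add_apply,
    Matrix.sub_apply, Matrix.smul_apply, smul_eq_mul, inv_zpow']
  have h1 := hasDerivAt_zpow (-m j) ζ (Or.inl hζ)
  have h2 := hasDerivAt_zpow (m k) ζ (Or.inl hζ)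
  refine ((h1.fun_mul (hf j k)).fun_mul h2).congr_deriv ?_
  rw [zpow_sub_one₀ hζ, zpow_sub_one₀ hζ]
  push_cast
  ring

end Gauge

/-! ### Existence and uniqueness of the normalizing automorphism -/

section Normalization

variable {r : ℕ}

theorem HasPolarPart.const_conj {Φ : ℂ → Matrix (Fin r) (Fin r) ℂ}
    {R : Matrix (Fin r) (Fin r) ℂ} (h : HasPolarPart Φ R) (P Q : Matrix (Fin r) (Fin r) ℂ) :
    HasPolarPart (fun ζ => P * Φ ζ * Q) (P * R * Q) := by
  obtain ⟨f, hf, h⟩ := h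
  refine ⟨fun ζ => P * f ζ * Q, ((MatAnalytic.const P).mul hf).mul (.const Q), ?_⟩
  filter_upwards [h] with ζ hζ
  simp only [hζ, mul_add, add_mul, mul_smul_comm, smul_mul_assoc]

/-- Needed to differentiate an identity that is known only off `0`. -/
theorem eventually_eq_nhds_of_punctured {α : Type*} {f g : ℂ → α}
    (h : ∀ᶠ ζ in 𝓝[≠] (0 : ℂ), f ζ = g ζ) :
    ∀ᶠ ζ in 𝓝[≠] (0 : ℂ), ∀ᶠ w in 𝓝 ζ, f w = g w := by
  filter_upwards [eventually_eventually_nhdsWithin.2 h, self_mem_nhdsWithin] with ζ h1 h2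
  rwa [isOpen_compl_singleton.nhdsWithin_eq h2] at h1

/-- The leading coefficient of a gauge transformation, meromorphic at infinity, between two
connections with the same diagonal residue at infinity. -/
theorem leading_coeff_gauge {q : ℂ → Matrix (Fin r) (Fin r) ℂ} (hq : MatEntire q)
    {D : Matrix (Fin r) (Fin r) ℂ} {C₁ C₂ : ℂ → Matrix (Fin r) (Fin r) ℂ}
    (h₁ : HasPolarPart C₁ D) (h₂ : HasPolarPart C₂ D)
    (h : ∀ ζ, ζ ≠ 0 → C₁ ζ * q ζ⁻¹ = q ζ⁻¹ * C₂ ζ - -((ζ ^ 2)⁻¹ • matDeriv q ζ⁻¹))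
    (s : ℕ) {u : ℂ → Matrix (Fin r) (Fin r) ℂ} (hu : MatAnalytic u)
    (hqu : ∀ᶠ ζ in 𝓝[≠] (0 : ℂ), ζ ^ s • q ζ⁻¹ = u ζ) :
    D * u 0 = u 0 * D + (s : ℂ) • u 0 := by
  obtain ⟨f₁, hf₁, h₁⟩ := h₁
  obtain ⟨f₂, hf₂, h₂⟩ := h₂
  -- Both sides are the gauge equation times `ζ^(s+1)`. The term `s • u` arises because `u'` also
  -- differentiates the factor `ζ^s`.
  have hL : MatAnalytic fun ζ => D * u ζ + ζ • (f₁ ζ * u ζ) :=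
    ((MatAnalytic.const D).mul hu).add (.smul analyticAt_id (MatAnalytic.mul hf₁ hu))
  have hR : MatAnalytic fun ζ =>
      u ζ * D + ζ • (u ζ * f₂ ζ - matDeriv u ζ) + (s : ℂ) • u ζ :=
    ((hu.mul (.const D)).add (.smul analyticAt_id ((hu.mul hf₂).sub hu.matDeriv))).add
      (.smul analyticAt_const hu)
  have key := hL.eq_at_zero hR ?_
  · simpa using key
  filter_upwards [h₁, h₂, eventually_eq_nhds_of_punctured hqu,
    nhdsWithin_le_nhds hu.eventually_matHasDerivAt, self_mem_nhdsWithin]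
    with ζ e₁ e₂ e₃ e₄ hζ
  replace hζ : ζ ≠ 0 := hζ
  have e₅ := (MatHasDerivAt.smul (hasDerivAt_pow s ζ) (hq.matHasDerivAt_comp_inv hζ)).unique e₄ e₃
  have e₆ := e₃.self_of_nhds
  have e₇ := h ζ hζ
  rw [e₁, e₂] at e₇
  rw [← e₅, ← e₆]
  generalize -((ζ ^ 2)⁻¹ • matDeriv q ζ⁻¹) = Q at e₇ ⊢
  -- For `s = 0` the exponent `s - 1` is truncated, but the factor `s` vanishes.
  have e₈ : (s : ℂ) * ζ ^ (s - 1) * ζ = s * ζ ^ s := by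
    cases s with
    | zero => simp
    | succ s => simp [pow_succ, mul_assoc]
  have e₉ := congrArg (fun X => (ζ ^ s * ζ) • X) e₇
  simp only [add_mul, mul_add, smul_mul_assoc, mul_smul_comm, smul_add, smul_sub, smul_smul,
    mul_assoc, mul_inv_cancel₀ hζ, mul_one] at e₉ ⊢
  rw [mul_comm ζ (_ * _), e₈]
  simp only [mul_comm ζ]
  linear_combination (norm := skip) e₉
  match_scalars <;> ring

/-- A gauge transformation, meromorphic at infinity, between two connections with the same
nonresonant diagonal residue at infinity is constant and diagonal. -/
theorem gauge_eq_const_diagonal {q : ℂ → Matrix (Fin r) (Fin r) ℂ} (hq : MatEntire q)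
    {μ : Fin r → ℂ} (hμ : ∀ j k, ∀ s : ℕ, μ j - μ k = s → j = k ∧ s = 0)
    {C₁ C₂ : ℂ → Matrix (Fin r) (Fin r) ℂ} (h₁ : HasPolarPart C₁ (Matrix.diagonal μ))
    (h₂ : HasPolarPart C₂ (Matrix.diagonal μ))
    (h : ∀ ζ, ζ ≠ 0 → C₁ ζ * q ζ⁻¹ = q ζ⁻¹ * C₂ ζ - -((ζ ^ 2)⁻¹ • matDeriv q ζ⁻¹))
    (s : ℕ) (u : ℂ → Matrix (Fin r) (Fin r) ℂ) (hu : MatAnalytic u)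
    (hqu : ∀ᶠ ζ in 𝓝[≠] (0 : ℂ), ζ ^ s • q ζ⁻¹ = u ζ) :
    ∃ d : Fin r → ℂ, ∀ z, q z = Matrix.diagonal d := by
  -- Entrywise, the relation for the leading coefficient reads `(μ j - μ k - s) * u 0 j k = 0`. The
  -- induction then lowers the pole order until `s = 0`.
  have hu0 : ∀ (s : ℕ) (u : ℂ → Matrix (Fin r) (Fin r) ℂ), MatAnalytic u →
      (∀ᶠ ζ in 𝓝[≠] (0 : ℂ), ζ ^ s • q ζ⁻¹ = u ζ) → ∀ j k, u 0 j k ≠ 0 → j = k ∧ s = 0 := by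
    intro s u hu hqu j k hne
    have h3 := congrFun (congrFun (leading_coeff_gauge hq h₁ h₂ h s hu hqu) j) k
    rw [Matrix.add_apply, Matrix.diagonal_mul, Matrix.mul_diagonal, Matrix.smul_apply,
      smul_eq_mul] at h3
    refine hμ j k s (mul_right_cancel₀ hne ?_)
    linear_combination h3
  induction s generalizing u with
  | zero =>
    refine ⟨fun j => u 0 j j, fun z => ?_⟩
    have hd : u 0 = Matrix.diagonal fun j => u 0 j j := by
      ext j k
      by_cases hjk : j = k
      · subst hjk; simp
      · rw [Matrix.diagonal_apply_ne _ hjk]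
        by_contra hne
        exact hjk (hu0 0 u hu hqu j k hne).1
    rw [← hd]
    ext j k
    refine eq_of_tendsto_inv (hq j k) ?_ z
    refine ((hu j k).continuousAt.tendsto.mono_left nhdsWithin_le_nhds).congr' ?_
    filter_upwards [hqu] with ζ hζ
    simp [← hζ]
  | succ s ih =>
    have h0 : u 0 = 0 := by
      ext j k
      by_contra hne
      exact absurd (hu0 _ u hu hqu j k hne).2 (Nat.succ_ne_zero s)
    obtain ⟨v, hv, huv⟩ := hu.exists_slope
    refine ih v hv ?_
    filter_upwards [hqu, self_mem_nhdsWithin] with ζ hζ hne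
    rw [huv, h0, zero_add, pow_succ', mul_smul] at hζ
    exact smul_right_injective _ hne hζ

theorem exists_int_sub_le (m : Fin r → ℤ) : ∃ T : ℕ, ∀ j k, m j - m k ≤ T := by
  obtain ⟨M, hM⟩ := (Set.finite_range fun p : Fin r × Fin r => m p.1 - m p.2).bddAbove
  exact ⟨M.toNat, fun j k => (hM ⟨(j, k), rfl⟩).trans (Int.self_le_toNat M)⟩

theorem exists_analytic_conj_powN (m : Fin r → ℤ) {T : ℕ} (hT : ∀ j k, m j - m k ≤ T)
    {f : ℂ → Matrix (Fin r) (Fin r) ℂ} (hf : MatAnalytic f) :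
    ∃ u, MatAnalytic u ∧ ∀ ζ, ζ ≠ 0 → ζ ^ T • (powN m ζ⁻¹ * f ζ * powN m ζ) = u ζ := by
  refine ⟨fun ζ => Matrix.of fun j k => ζ ^ (m k - m j + T).toNat * f ζ j k, fun j k =>
    (analyticAt_id.pow _).fun_mul (hf j k), fun ζ hζ => ?_⟩
  ext j k
  simp only [Matrix.smul_apply, powN, Matrix.mul_diagonal, Matrix.diagonal_mul, Matrix.of_apply,
    smul_eq_mul]
  have h1 : ζ ^ (m k - m j + T).toNat = ζ ^ T * (ζ⁻¹ ^ m j * ζ ^ m k) := by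
    rw [inv_zpow', ← zpow_natCast, ← zpow_natCast, ← zpow_add₀ hζ, ← zpow_add₀ hζ]
    congr 1
    have := hT j k
    omega
  rw [h1]
  ring

theorem exists_normalizing_bundleAut (m : Fin r → ℤ) {A : ℂ → Matrix (Fin r) (Fin r) ℂ}
    {R Y₀ : Matrix (Fin r) (Fin r) ℂ} {a : Fin r → ℂ} (hA : HasPolarPart (formAtInfty m A) R)
    (hY₀ : IsUnit Y₀) (hR : R * Y₀ = Y₀ * Matrix.diagonal a)
    (ha : ∀ j k, ∀ s : ℕ, a j - a k + (s + 1) ≠ 0)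
    (hblock : ∀ (c : ℤ) (w : Fin r → ℂ), (∀ l, c < m l → w l = 0) →
      (∀ k, m k ≤ c → Matrix.vecMul w Y₀ k = 0) → w = 0) :
    ∃ g : BundleAut m, HasPolarPart (inZeta (g.act A)) (Matrix.diagonal a + splitN m) := by
  obtain ⟨f, hf, hA⟩ := hA
  obtain ⟨T, hT⟩ := exists_int_sub_le m
  obtain ⟨Y, hY0, E, hE, hYE⟩ := exists_approx_gauge (r := r) hf hY₀ hR ha T
  obtain ⟨g, H, hH⟩ := exists_bundleAut m Y (by rwa [hY0])
  obtain ⟨E₂, hE₂, hE₂'⟩ := exists_analytic_conj_powN m hT (g.entire₁.matAnalytic.mul hE)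
  refine ⟨g, ?_⟩
  set D := Matrix.diagonal a + splitN m with hD
  have hHa := MatAnalytic.eval H
  have hK : MatAnalytic fun ζ => 1 + ζ • H.map (Polynomial.eval ζ) :=
    (MatAnalytic.const 1).add (.smul analyticAt_id hHa)
  have hK0 : (1 + (0 : ℂ) • H.map (Polynomial.eval 0)).det ≠ 0 := by simp
  -- This is what `k₈` leaves after `D/ζ` is subtracted: the commutator of `D` with `1 + ζH` already
  -- carries a factor `ζ`, so it cancels the pole.
  refine ⟨fun ζ => (H.map (Polynomial.eval ζ) * D - D * H.map (Polynomial.eval ζ) + E₂ ζ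
    - matDeriv (fun ζ => 1 + ζ • H.map (Polynomial.eval ζ)) ζ)
      * (1 + ζ • H.map (Polynomial.eval ζ))⁻¹, ((((hHa.mul (.const D)).sub
        ((MatAnalytic.const D).mul hHa)).add hE₂).sub hK.matDeriv).mul (hK.inv hK0), ?_⟩
  filter_upwards [hA, self_mem_nhdsWithin, nhdsWithin_le_nhds hK.eventually_matHasDerivAt,
    nhdsWithin_le_nhds (hK.det.continuousAt.eventually_ne hK0)] with ζ e₁ hζ e₂ e₃
  replace hζ : ζ ≠ 0 := hζ
  have e₄ := matHasDerivAt_conj_powN m hζ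
    (f := fun ζ => Y.map (Polynomial.eval ζ))
    (f' := Y.map fun p => (Polynomial.derivative p).eval ζ)
    (fun j k => (Y j k).hasDerivAt ζ)
  have e₅ := (g.entire₀.matHasDerivAt_comp_inv hζ).mul e₄
  have e₆ := e₂.unique e₅ (by
    filter_upwards [isOpen_compl_singleton.mem_nhds hζ] with w hw
    rw [← hH w hw, g.g₀_inv_eq hw]
    simp only [mul_assoc]
    rw [← mul_assoc (powN m w) (powN m w⁻¹), powN_mul_powN_inv m hw, one_mul])
  have e₇ := inZeta_act_mul g A ζ
  have e₈ := inZeta_eq m A hζ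
  have e₉ := hYE ζ hζ
  have e₁₀ := hE₂' ζ hζ
  have e₁₁ := hH ζ hζ
  have hG := g.g₀_inv_eq hζ
  rw [e₁] at e₈
  rw [e₆]
  have hN1 := powN_mul_splitN m ζ⁻¹
  have hPp := powN_mul_powN_inv m hζ
  have hPa : powN m ζ * Matrix.diagonal a = Matrix.diagonal a * powN m ζ := by
    simp only [powN, Matrix.diagonal_mul_diagonal, mul_comm]
  set p := powN m ζ⁻¹
  set P := powN m ζ
  set y := Y.map (Polynomial.eval ζ)
  set y' := Y.map fun p => (Polynomial.derivative p).eval ζ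
  set G' := -((ζ ^ 2)⁻¹ • matDeriv g.g₀ ζ⁻¹)
  set G := g.g₀ ζ⁻¹
  set η := H.map (Polynomial.eval ζ)
  set C := inZeta A ζ
  set Z := p * y * P with hZ
  have k₁ : C * Z = p * ((ζ⁻¹ • R + f ζ) * y) * P + ζ⁻¹ • (splitN m * Z) := by
    calc C * Z = p * (ζ⁻¹ • R + f ζ + ζ⁻¹ • splitN m) * (P * p) * (y * P) := by
          rw [e₈, hZ]; simp only [mul_assoc]
      _ = p * ((ζ⁻¹ • R + f ζ) * y) * P + ζ⁻¹ • (p * splitN m * y * P) := by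
          rw [hPp, mul_one]
          simp only [mul_add, add_mul, mul_smul_comm, smul_mul_assoc, mul_assoc]
      _ = _ := by rw [hN1, hZ]; simp only [mul_assoc]
  have k₂ : p * ((ζ⁻¹ • R + f ζ) * y) * P + p * y' * P
      = ζ⁻¹ • (Z * Matrix.diagonal a) + ζ ^ T • (p * E ζ * P) := by
    rw [← add_mul, ← mul_add, e₉, hZ, mul_assoc (p * y) P, hPa]
    simp only [mul_add, add_mul, mul_smul_comm, smul_mul_assoc, mul_assoc]
  -- The term `N Z` from the change of frame cancels against the derivative of `ζ^(-N)`, while the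
  -- derivative of `ζ^N` contributes `Z N`; hence the residue `D = diag(a) + N`.
  have k₃ : C * Z + (ζ⁻¹ • (Z * splitN m - splitN m * Z) + p * y' * P)
      = ζ⁻¹ • (Z * D) + ζ ^ T • (p * E ζ * P) := by
    rw [k₁, hD, mul_add, smul_add, smul_sub]
    linear_combination (norm := skip) k₂
    module
  have k₄ : G * Z = 1 + ζ • η := by
    rw [← e₁₁, hG, hZ]
    simp only [mul_assoc]
    rw [← mul_assoc P p, hPp, one_mul]
  have k₅ : ζ ^ T • (G * (p * E ζ * P)) = E₂ ζ := by
    rw [← e₁₀, hG]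
    simp only [mul_assoc]
    rw [← mul_assoc P p, hPp, one_mul]
  have k₆ : inZeta (g.act A) ζ * (1 + ζ • η)
      = ζ⁻¹ • ((1 + ζ • η) * D) + E₂ ζ
        - (G' * Z + G * (ζ⁻¹ • (Z * splitN m - splitN m * Z) + p * y' * P)) := by
    have k₇ := congrArg (G * ·) k₃
    simp only [mul_add G, mul_smul_comm, ← mul_assoc G Z, k₄] at k₇
    rw [k₅] at k₇
    rw [← k₇, ← k₄, ← mul_assoc, e₇]
    simp only [mul_add, sub_mul, mul_assoc, mul_smul_comm]
    abel
  have hu : IsUnit (1 + ζ • η).det := e₃.isUnit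
  have k₈ : (inZeta (g.act A) ζ - ζ⁻¹ • D) * (1 + ζ • η) = η * D - D * η + E₂ ζ
        - (G' * Z + G * (ζ⁻¹ • (Z * splitN m - splitN m * Z) + p * y' * P)) := by
    rw [sub_mul, k₆]
    simp only [add_mul, mul_add, one_mul, mul_one, smul_mul_assoc, mul_smul_comm, smul_add,
      smul_smul, inv_mul_cancel₀ hζ, mul_inv_cancel₀ hζ, one_smul]
    abel
  rw [← k₈, mul_assoc, Matrix.mul_nonsing_inv _ hu, mul_one]
  abel

theorem matAd_permMatrix_diagonal (σ : Equiv.Perm (Fin r)) (a : Fin r → ℂ) :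
    matAd (σ.permMatrix ℂ) (Matrix.diagonal a) = Matrix.diagonal (a ∘ σ) := by
  ext i j
  rw [matAd, inv_permMatrix, mul_permMatrix_apply, Matrix.mul_diagonal]
  by_cases h : i = j <;>
    simp [h, ← Equiv.Perm.inv_def, Equiv.Perm.permMatrix]

theorem matAd_permMatrix_weight_add (m : Fin r → ℤ) (a : Fin r → ℝ) (σ : Equiv.Perm (Fin r)) :
    matAd (σ.permMatrix ℂ) (weightW a + matAd (σ.permMatrix ℂ)⁻¹ (splitN m))
      = Matrix.diagonal fun j => (a (σ j) : ℂ) + m j := by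
  have h1 : matAd (σ.permMatrix ℂ)⁻¹ (splitN m)
      = Matrix.diagonal ((fun j => (m j : ℂ)) ∘ (σ⁻¹ : Equiv.Perm (Fin r))) := by
    rw [inv_permMatrix, splitN, matAd_permMatrix_diagonal]
  rw [h1, weightW, Matrix.diagonal_add, matAd_permMatrix_diagonal]
  congr 1
  funext j
  simp

theorem BundleAut.act_of_diagonal {m : Fin r → ℤ} {g h : BundleAut m} {d : Fin r → ℂ}
    (hgh : ∀ w, h.g₀ w = Matrix.diagonal d * g.g₀ w)
    (A : ℂ → Matrix (Fin r) (Fin r) ℂ) (z : ℂ) :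
    h.act A z = Matrix.diagonal d * g.act A z * (Matrix.diagonal d)⁻¹ := by
  have h1 : matDeriv h.g₀ z = Matrix.diagonal d * matDeriv g.g₀ z := by
    ext j k
    simp [matDeriv, hgh, Matrix.diagonal_mul]
  rw [BundleAut.act, BundleAut.act, h1, hgh, Matrix.mul_inv_rev]
  simp only [mul_sub, sub_mul, mul_assoc]

theorem diagonal_mul_diagonal_mul_inv {d : Fin r → ℂ} (hd : ∀ j, d j ≠ 0) (μ : Fin r → ℂ) :
    Matrix.diagonal d * Matrix.diagonal μ * (Matrix.diagonal d)⁻¹ = Matrix.diagonal μ := by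
  have hu : IsUnit (Matrix.diagonal d).det := by
    rw [Matrix.det_diagonal]
    exact (Finset.prod_ne_zero_iff.2 fun j _ => hd j).isUnit
  have hc : Matrix.diagonal d * Matrix.diagonal μ = Matrix.diagonal μ * Matrix.diagonal d := by
    simp only [Matrix.diagonal_mul_diagonal, mul_comm]
  rw [hc, mul_assoc, Matrix.mul_nonsing_inv _ hu, mul_one]

/-- Two automorphisms that bring a connection into forms with the same nonresonant diagonal
residue at infinity, in the trivialization over `ℂ`, differ by a constant diagonal matrix. -/
theorem BundleAut.normalized_iff {m : Fin r → ℤ} {A : ℂ → Matrix (Fin r) (Fin r) ℂ}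
    {μ : Fin r → ℂ} (hμ : ∀ j k, ∀ s : ℕ, μ j - μ k = s → j = k ∧ s = 0) {g : BundleAut m}
    (hg : HasPolarPart (inZeta (g.act A)) (Matrix.diagonal μ)) (h : BundleAut m) :
    HasPolarPart (inZeta (h.act A)) (Matrix.diagonal μ) ↔
      ∃ d : Fin r → ℂ, (∀ j, d j ≠ 0) ∧ ∀ w, h.g₀ w = Matrix.diagonal d * g.g₀ w := by
  constructor
  · intro hh
    have hgd : ∀ z, IsUnit (g.g₀ z).det := fun z => (Matrix.isUnit_iff_isUnit_det _).1 (g.isUnit₀ z)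
    have hq : MatEntire fun z => h.g₀ z * (g.g₀ z)⁻¹ := h.entire₀.mul (g.entire₀.inv g.isUnit₀)
    set q := fun z => h.g₀ z * (g.g₀ z)⁻¹ with hqdef
    have hqg : ∀ z, q z * g.g₀ z = h.g₀ z := fun z => by
      rw [hqdef]
      simp only [mul_assoc, Matrix.nonsing_inv_mul _ (hgd z), mul_one]
    have hgauge : ∀ ζ, ζ ≠ 0 → inZeta (h.act A) ζ * q ζ⁻¹
        = q ζ⁻¹ * inZeta (g.act A) ζ - -((ζ ^ 2)⁻¹ • matDeriv q ζ⁻¹) := by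
      intro ζ hζ
      have h1 := inZeta_act_mul h A ζ
      have h2 := inZeta_act_mul g A ζ
      have h3 := (h.entire₀.matHasDerivAt_comp_inv hζ).unique
        ((hq.matHasDerivAt_comp_inv hζ).mul (g.entire₀.matHasDerivAt_comp_inv hζ))
        (Eventually.of_forall fun w => (hqg w⁻¹).symm)
      rw [h3, ← hqg] at h1
      have h4 : (inZeta (h.act A) ζ * q ζ⁻¹) * g.g₀ ζ⁻¹ = (q ζ⁻¹ * inZeta (g.act A) ζ
          - -((ζ ^ 2)⁻¹ • matDeriv q ζ⁻¹)) * g.g₀ ζ⁻¹ := by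
        rw [mul_assoc, h1, sub_mul, mul_assoc (q ζ⁻¹) (inZeta _ _), h2, mul_sub, mul_assoc]
        abel
      exact (g.isUnit₀ ζ⁻¹).mul_right_cancel h4
    obtain ⟨T, hT⟩ := exists_int_sub_le m
    have hg1 : ∀ ζ, IsUnit (g.g₁ ζ).det := fun ζ =>
      (Matrix.isUnit_iff_isUnit_det _).1 (g.isUnit₁ ζ)
    -- On the overlap `q = z^N (h₁g₁⁻¹) z^(-N)` with `h₁g₁⁻¹` holomorphic at `∞`, so the pole of `q`
    -- there has order at most `T`.
    obtain ⟨u, hu, hu'⟩ := exists_analytic_conj_powN m hT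
      (h.entire₁.mul (g.entire₁.inv g.isUnit₁)).matAnalytic
    obtain ⟨d, hd⟩ := gauge_eq_const_diagonal hq hμ hh hg hgauge T u hu (by
      filter_upwards [self_mem_nhdsWithin] with ζ hζ
      replace hζ : ζ ≠ 0 := hζ
      rw [← hu' ζ hζ]
      congr 1
      refine (g.isUnit₀ ζ⁻¹).mul_right_cancel ?_
      rw [hqg, h.g₀_inv_eq hζ, g.g₀_inv_eq hζ]
      simp only [mul_assoc]
      rw [← mul_assoc (powN m ζ) (powN m ζ⁻¹), powN_mul_powN_inv m hζ, one_mul,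
        ← mul_assoc (g.g₁ ζ)⁻¹, Matrix.nonsing_inv_mul _ (hg1 ζ), one_mul])
    refine ⟨d, fun j => ?_, fun w => by rw [← hd w, hqg]⟩
    have h5 : (Matrix.diagonal d).det ≠ 0 := by
      have h6 := congrArg Matrix.det (hqg 0)
      rw [hd, Matrix.det_mul] at h6
      exact left_ne_zero_of_mul (h6 ▸ ((Matrix.isUnit_iff_isUnit_det _).1 (h.isUnit₀ 0)).ne_zero)
    rw [Matrix.det_diagonal] at h5
    exact Finset.prod_ne_zero_iff.1 h5 j (Finset.mem_univ j)
  · rintro ⟨d, hd, hgh⟩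
    have h1 := hg.const_conj (Matrix.diagonal d) (Matrix.diagonal d)⁻¹
    rw [diagonal_mul_diagonal_mul_inv hd] at h1
    have h2 : inZeta (h.act A) = fun ζ =>
        Matrix.diagonal d * inZeta (g.act A) ζ * (Matrix.diagonal d)⁻¹ := by
      funext ζ
      simp only [inZeta, BundleAut.act_of_diagonal hgh, mul_neg, neg_mul, mul_smul_comm,
        smul_mul_assoc]
    rwa [h2]

theorem eq_of_sub_eq_int {a : Fin r → ℝ} (ha : StrictMono a) (h0 : ∀ j, 0 ≤ a j)
    (h1 : ∀ j, a j < 1) {j k : Fin r} {n : ℤ} (h : (a j : ℂ) - a k = n) : j = k ∧ n = 0 := by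
  have h2 : a j - a k = n := by exact_mod_cast h
  have h3 : (n : ℝ) < 1 := by linarith [h0 k, h1 j]
  have h4 : (-1 : ℝ) < n := by linarith [h0 j, h1 k]
  have h5 : n < 1 := by exact_mod_cast h3
  have h6 : -1 < n := by exact_mod_cast h4
  have h7 : n = 0 := by omega
  refine ⟨ha.injective ?_, h7⟩
  rw [h7] at h2
  simpa [sub_eq_zero] using h2

end Normalization

/-! ### The normal form at infinity -/

theorem mainTheorem6 {k r : ℕ} (z : Fin k → ℂ) (hz : Function.Injective z)
    (m : Fin r → ℤ) (hm : Monotone m)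
    (α : Fin (k + 1) → Fin r → ℝ) (hα : ∀ i, StrictMono (α i))
    (hα0 : ∀ i j, 0 ≤ α i j) (hα1 : ∀ i j, α i j < 1)
    (F : Fin (k + 1) → Fin r → Submodule ℂ (Fin r → ℂ))
    (A : ℂ → Matrix (Fin r) (Fin r) ℂ) (hA : IsAdaptedConnection z m α F A) :
    (∃ σ : Equiv.Perm (Fin r), IsBruhatRep m (F (Fin.last k)) σ) ∧
    ∀ σ : Equiv.Perm (Fin r), IsBruhatRep m (F (Fin.last k)) σ →
      ∃ g : BundleAut m, IsNormalizedAtInfty m (α (Fin.last k)) σ (g.act A) ∧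
        ∀ h : BundleAut m, IsNormalizedAtInfty m (α (Fin.last k)) σ (h.act A) ↔
          ∃ d : Fin r → ℂ, (∀ j, d j ≠ 0) ∧ ∀ w, h.g₀ w = Matrix.diagonal d * g.g₀ w := by
  obtain ⟨R, -, -, -, hpolar, hres⟩ := hA
  obtain ⟨B, hB, hRB, hF⟩ := hres (Fin.last k)
  refine ⟨by rw [hF]; exact exists_isBruhatRep hm hB, fun σ hσ => ?_⟩
  obtain ⟨P, hP, hFP⟩ := hσ
  obtain ⟨L, hBL, hL, hL'⟩ := exists_lower_of_flagAct_eq hB (hP.1.mul (isUnit_permMatrix σ))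
    (hF.symm.trans hFP)
  have hsub : ∀ {i j : Fin r} {n : ℤ}, (α (Fin.last k) i : ℂ) - α (Fin.last k) j = n →
      i = j ∧ n = 0 := eq_of_sub_eq_int (hα _) (hα0 _) (hα1 _)
  set a := α (Fin.last k)
  set S := σ.permMatrix ℂ
  have hSd : IsUnit S.det := (Matrix.isUnit_iff_isUnit_det _).1 (isUnit_permMatrix σ)
  have hBd : IsUnit B.det := (Matrix.isUnit_iff_isUnit_det _).1 hB
  -- Permuting the eigenbasis `B` by `Π⁻¹` gives `Y₀ = P(ΠLΠ⁻¹)`, the shape required for the block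
  -- condition.
  have hRY : R (Fin.last k) * (B * S⁻¹) = B * S⁻¹ * Matrix.diagonal fun j => (a (σ j) : ℂ) := by
    have h1 := matAd_permMatrix_diagonal σ fun j => (a j : ℂ)
    have h2 : (Matrix.diagonal fun j => (a (σ j) : ℂ)) = S * weightW a * S⁻¹ := h1.symm
    rw [h2, hRB, matAd]
    calc _ = B * weightW a * (B⁻¹ * B) * S⁻¹ := by simp only [mul_assoc]
      _ = B * (S⁻¹ * S) * weightW a * S⁻¹ := by
        rw [Matrix.nonsing_inv_mul _ hBd, Matrix.nonsing_inv_mul _ hSd, mul_one, mul_one]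
      _ = _ := by simp only [mul_assoc]
  obtain ⟨g, hg⟩ := exists_normalizing_bundleAut m hpolar
    (hB.mul (Matrix.isUnit_nonsing_inv_iff.2 (isUnit_permMatrix σ))) hRY
    (fun i j s h => by
      have h1 := @hsub (σ i) (σ j) (-(s + 1)) (by push_cast; linear_combination h)
      omega)
    (fun c w hw h => leading_block_nondegenerate hP σ hL hL' c w hw (by rwa [← hBL]))
  have hdiag : (Matrix.diagonal fun j => (a (σ j) : ℂ)) + splitN m
      = Matrix.diagonal fun j => (a (σ j) : ℂ) + m j := Matrix.diagonal_add _ _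
  rw [hdiag] at hg
  -- Adding the integers `m` does not affect whether a difference is an integer, and distinct
  -- weights in `[0, 1)` never differ by one.
  have hμ : ∀ i j, ∀ s : ℕ, ((a (σ i) : ℂ) + m i) - (a (σ j) + m j) = s → i = j ∧ s = 0 := by
    intro i j s h
    obtain ⟨h1, h2⟩ := @hsub (σ i) (σ j) (s - m i + m j) (by push_cast; linear_combination h)
    have h3 := σ.injective h1
    subst h3
    exact ⟨rfl, by omega⟩
  refine ⟨g, ?_, fun h => ?_⟩
  · rwa [IsNormalizedAtInfty, matAd_permMatrix_weight_add]
  · rw [IsNormalizedAtInfty, matAd_permMatrix_weight_add]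
    exact BundleAut.normalized_iff hμ hg h
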